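/- Work in $\mathsf{ZFC}$. Let $\mathbb{R}={}^\omega\omega$ be the Baire space with the metric $d(x,y)=2^{-n}$, $n$ least with $x(n)\ne y(n)$, and write $\neg A=\mathbb{R}\setminus A$. Let $\mathsf{Lip}(C)$ be the set of functions $\mathbb{R}\to\mathbb{R}$ that are Lipschitz with constant at most $C$, $\mathsf{L}=\mathsf{Lip}(1)$, $\mathsf{Lip}=\bigcup_{k\in\mathbb{Z}}\mathsf{Lip}(2^k)$, and $\mathsf{Bor}$ the set of Borel functions. For a set $\mathcal{F}$ of functions from $\mathbb{R}$ to $\mathbb{R}$ put $A\le_{\mathcal F}B$ iff $A=f^{-1}(B)$ for some $f\in\mathcal F$; put $A<_{\mathcal F}B$ iff $A\le_{\mathcal F}B$ and $B\not\le_{\mathcal F}A$, and $A\equiv_{\mathcal F}B$ iff $A\le_{\mathcal F}B$ and $B\le_{\mathcal F}A$; let $[A]_{\mathcal F}=\{B: B\equiv_{\mathcal F}A\}$; $A$ is *$\mathcal F$-selfdual* if $A\le_{\mathcal F}\neg A$. The *characteristic set* is $\Delta_{\mathcal F}=\{A: A\le_{\mathcal F}\{x: x(0)=0\}\}$. A *$\Delta_{\mathcal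 F}$-partition* of $\mathbb{R}$ is a sequence $\langle D_n\mid n\in\omega\rangle$ of pairwise disjoint (possibly empty) sets in $\Delta_{\mathcal F}$ with union $\mathbb{R}$. $\mathcal F$ is a *Borel-amenable set of reductions* if it is closed under composition, is a surjective image of $\mathbb{R}$, $\mathsf{Lip}\subseteq\mathcal F\subseteq\mathsf{Bor}$ (so in particular $\mathsf{L}\subseteq\mathcal F$), and $\bigcup_n(f_n{\restriction}D_n)\in\mathcal F$ for every $\Delta_{\mathcal F}$-partition $\langle D_n\rangle$ of $\mathbb{R}$ and all $f_n\in\mathcal F$. A set $A$ has the *decomposition property* with respect to $\mathcal F$ if there is a $\Delta_{\mathcal F}$-partition $\langle D_n\rangle$ of $\mathbb{R}$ with $D_n\cap A<_{\mathcal F}A$ for every $n$. In the Lipschitz hierarchy, $B$ is a *successor of* $C$ if $C<_{\mathsf L}B$ and there is no $D$ with $C<_{\mathsf L}D<_{\mathsf L}B$; $B$ is *limit* if it is not a successor of any set and $B\not\equiv_{\mathsf L}\mathbb{R}$, $B\not\equiv_{\mathsf L}\emptyset$; $B$ has *countable cofinality* if there are $A_n<_{\mathsf L}B$ ($n\in\omega$)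 such that no $D<_{\mathsf L}B$ satisfies $A_n\le_{\mathsf L}D$ for all $n$; and $B$ is *successor of a nonselfdual pair* if there is $C$ with $C\not\le_{\mathsf L}\neg C$ such that $B$ is a successor of both $C$ and $\neg C$. A set $B$ is *$\mathsf L$-minimal in* $[A]_{\mathcal F}$ if $B\in[A]_{\mathcal F}$ and there is no $C\in[A]_{\mathcal F}$ with $C<_{\mathsf L}B$. Let $\Gamma\subseteq\mathscr{P}(\mathbb{R})$ be closed under complements and under preimages by Borel functions, and assume the following for the sets in $\Gamma$: - $\mathsf{SLO^L}$ on $\Gamma$: for all $A,B\in\Gamma$, $A\le_{\mathsf L}B$ or $\neg B\le_{\mathsf L}A$; - $\neg\mathsf{FS}$ on $\Gamma$: no $S\in\Gamma$ is a flip-set, where $S\subseteq{}^\omega2\subseteq\mathbb{R}$ is a flip-set if for all $z,w\in{}^\omega2$ that differ at exactly one place, $z\in S\iff w\notin S$. **Corollary.** Let $\mathcal F$ be a Borel-amenable set of reductions and let $A\in\Gamma$ with $A\notin\Delta_{\mathcal F}$. Then the following are equivalent: 1. $A\le_{\mathcal F}\neg A$; 2. $A$ has the decomposition property with respect to $\mathcal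 F$; 3. for every $B$ that is $\mathsf L$-minimal in $[A]_{\mathcal F}$, $B\le_{\mathsf L}\neg B$ and $B$ is either limit of countable cofinality or successor of a nonselfdual pair with respect to $\le_{\mathsf L}$. (For $\Gamma=\mathscr{P}(\mathbb{R})$ the two assumptions are literally $\mathsf{SLO^L}$ and $\neg\mathsf{FS}$. $\mathsf{DC}(\mathbb{R})$ is a theorem of $\mathsf{ZFC}$.) -/

import Mathlib

open Set
open scoped NNReal

namespace WadgeHierarchy

/-- The Baire space, i.e. the space of reals, with the product topology and its Borel sets. -/
abbrev Baire : Type := ℕ → ℕ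

/-- Functions with Lipschitz constant at most `C`, for the metric `d(x,y) = 2⁻ⁿ`, where `n` is
the first place at which `x` and `y` differ. -/
def LipConst (C : ℝ≥0) : Set (Baire → Baire) :=
  {f | letI := PiNat.metricSpaceNatNat; LipschitzWith C f}

/-- `Lip`: all Lipschitz functions. -/
def Lip : Set (Baire → Baire) := ⋃ k : ℤ, LipConst ((2 : ℝ≥0) ^ k)

/-- `L`: Lipschitz functions with constant at most one. -/
def L : Set (Baire → Baire) := LipConst 1

/-- `Bor`: Borel functions. -/
def Bor : Set (Baire → Baire) := {f | Measurable f}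

/-- `A ≤_F B`: the set `A` is `F`-reducible to `B`. -/
def Red (F : Set (Baire → Baire)) (A B : Set Baire) : Prop := ∃ f ∈ F, A = f ⁻¹' B

/-- `A <_F B`. -/
def SRed (F : Set (Baire → Baire)) (A B : Set Baire) : Prop := Red F A B ∧ ¬ Red F B A

/-- `A ≡_F B`. -/
def Equiv (F : Set (Baire → Baire)) (A B : Set Baire) : Prop := Red F A B ∧ Red F B A

/-- The `F`-degree of `A`. -/
def degree (F : Set (Baire → Baire)) (A : Set Baire) : Set (Set Baire) := {B | Equiv F B A}

/-- `A` is `F`-selfdual. -/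
def Selfdual (F : Set (Baire → Baire)) (A : Set Baire) : Prop := Red F A Aᶜ

/-- The degree of `A` is a successor of the degree of `B`. -/
def SuccessorOf (F : Set (Baire → Baire)) (A B : Set Baire) : Prop :=
  SRed F B A ∧ ¬ ∃ C, SRed F B C ∧ SRed F C A

/-- The degree of `A` is a successor degree. -/
def IsSuccessor (F : Set (Baire → Baire)) (A : Set Baire) : Prop := ∃ B, SuccessorOf F A B

/-- The degree of `A` is a limit degree. -/
def IsLimit (F : Set (Baire → Baire)) (A : Set Baire) : Prop :=
  ¬ IsSuccessor F A ∧ ¬ Equiv F A univ ∧ ¬ Equiv F A ∅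

/-- The degree of `A` has countable cofinality: it is minimal among the upper bounds of a
countable family of strictly smaller degrees. -/
def CountableCofinality (F : Set (Baire → Baire)) (A : Set Baire) : Prop :=
  ∃ S : ℕ → Set Baire, (∀ n, SRed F (S n) A) ∧ ∀ B, (∀ n, Red F (S n) B) → ¬ SRed F B A

/-- The degree of `A` is a successor of (both members of) a nonselfdual pair. -/
def SuccessorOfNonselfdualPair (F : Set (Baire → Baire)) (A : Set Baire) : Prop :=
  ∃ C, ¬ Selfdual F C ∧ SuccessorOf F A C ∧ SuccessorOf F A Cᶜ

/-- `B` is `L`-minimal in the `F`-degree of `A`. -/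
def LMinimalIn (F : Set (Baire → Baire)) (A B : Set Baire) : Prop :=
  B ∈ degree F A ∧ ∀ C ∈ degree F A, ¬ SRed L C B

/-- The characteristic set `Δ_F`: all sets that are `F`-reducible to `{x | x(0) = 0}`. -/
def charSet (F : Set (Baire → Baire)) : Set (Set Baire) := {A | Red F A {x : Baire | x 0 = 0}}

/-- `D` is a `Γ`-partition of the whole space (empty pieces are allowed). -/
def IsPartitionOf (Γ : Set (Set Baire)) (D : ℕ → Set Baire) : Prop :=
  (∀ n, D n ∈ Γ) ∧ Pairwise (fun m n => Disjoint (D m) (D n)) ∧ ⋃ n, D n = univ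

/-- Sets of reductions. -/
structure IsSetOfReductions (F : Set (Baire → Baire)) : Prop where
  comp_mem : ∀ f ∈ F, ∀ g ∈ F, f ∘ g ∈ F
  L_subset : L ⊆ F
  exists_surjection : ∃ j : Baire → (Baire → Baire), range j = F

/-- Borel-amenable sets of reductions. -/
structure IsBorelAmenable (F : Set (Baire → Baire)) : Prop extends IsSetOfReductions F where
  subset_Bor : F ⊆ Bor
  Lip_subset : Lip ⊆ F
  glue_mem : ∀ D : ℕ → Set Baire, IsPartitionOf (charSet F) D →
    ∀ f : ℕ → Baire → Baire, (∀ n, f n ∈ F) →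
    ∀ g : Baire → Baire, (∀ n, ∀ x ∈ D n, g x = f n x) → g ∈ F

/-- `A` has the decomposition property with respect to `F`. -/
def HasDecompositionProperty (F : Set (Baire → Baire)) (A : Set Baire) : Prop :=
  ∃ D : ℕ → Set Baire, IsPartitionOf (charSet F) D ∧ ∀ n, SRed F (D n ∩ A) A

/-- The semi-linear ordering principle for `F`, for the sets in `Γ`. For `Γ = univ` this is the
full principle. -/
def SLO (F : Set (Baire → Baire)) (Γ : Set (Set Baire)) : Prop :=
  ∀ A ∈ Γ, ∀ B ∈ Γ, Red F A B ∨ Red F Bᶜ A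

/-- The Cantor space, as a subset of the Baire space. -/
def cantorSet : Set Baire := {x | ∀ n, x n < 2}

/-- Flip-sets. -/
def IsFlipSet (S : Set Baire) : Prop :=
  S ⊆ cantorSet ∧ ∀ z ∈ cantorSet, ∀ w ∈ cantorSet, (∃! n, z n ≠ w n) → (z ∈ S ↔ w ∉ S)

/-- There are no flip-sets in `Γ`. For `Γ = univ` this is the full principle. -/
def NoFlipSets (Γ : Set (Set Baire)) : Prop := ∀ S ∈ Γ, ¬ IsFlipSet S

/-- `Γ` is closed under complements and under preimages by Borel functions. All sets, the Borel
sets and the projective sets are examples. -/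
structure IsSelfdualBorPointclass (Γ : Set (Set Baire)) : Prop where
  compl_mem : ∀ A ∈ Γ, Aᶜ ∈ Γ
  preimage_mem : ∀ A ∈ Γ, ∀ f ∈ Bor, f ⁻¹' A ∈ Γ

end WadgeHierarchy

/-! Wadge-style games drive the argument: `shift A` ignores one digit, so `shift A ≤_L B` says that
`A` reduces to `B` by a contraction, and `loc A k` is what remains of `A` after the move `k`. (1 ⇒
2) Suppose `A` is `F`-selfdual without the decomposition property. Then `A` reduces to itself by
maps in `F` whose range lies in a piece on which finitely many prescribed coordinates of earlier
maps are constant. Following these by choice with a reduction of `A` to its complement gives, for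
each infinite binary sequence, an infinite composition in which every coordinate is eventually
decided. Its value depends on the sequence as a flip-set would (`false_of_flip_system`). Passing to
the limit needs continuity, which maps in `F` lack. Instead each of them is a continuous image of a
map with closed graph and fibres in `Δ_F` (`exists_resolves_of_mem`), a change of topology that
stays inside `Δ_F` thanks to the ordering principle. (2 ⇒ 1) Each piece lies strictly below `A`,
hence also reduces to `Aᶜ`; the reductions are glued. (1 ⇒ 3) If `B` is minimal, comparing it with
the sum of the pieces of a decomposition puts every localization of `B` strictly below `B`. A set
that is not `L`-selfdual reduces to one of its localizations (`exists_red_loc`), so `B` is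
`L`-selfdual. It cannot be a successor of a selfdual `C`, because then `B ≤_L shift C`, which is
`F`-equivalent to `C`. (3 ⇒ 1) The Lipschitz hierarchy is well-founded (Martin–Monk), so a minimal
`B` exists, and its selfduality passes to `A`. -/

namespace WadgeHierarchy

/-! ### Shifts, localizations and the digitwise form of Lipschitz maps. -/

/-- The sequence `k⌢x`. -/
def cons (k : ℕ) (x : Baire) : Baire
  | 0 => k
  | n + 1 => x n

/-- The sequence `x` without its first entry. -/
def tail (x : Baire) : Baire := fun n => x (n + 1)

@[simp] lemma cons_zero (k : ℕ) (x : Baire) : cons k x 0 = k := rfl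

@[simp] lemma tail_cons (k : ℕ) (x : Baire) : tail (cons k x) = x := rfl

@[simp] lemma cons_tail (x : Baire) : cons (x 0) (tail x) = x := by
  funext n
  cases n <;> rfl

/-- The set of all `k⌢x` with `x ∈ A`. -/
def shift (A : Set Baire) : Set Baire := tail ⁻¹' A

/-- The localization of `A` at the sequence `⟨k⟩`. -/
def loc (A : Set Baire) (k : ℕ) : Set Baire := cons k ⁻¹' A

lemma mem_L_iff {f : Baire → Baire} :
    f ∈ L ↔ ∀ (n : ℕ) (x y : Baire), (∀ i < n, x i = y i) → ∀ i < n, f x i = f y i := by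
  let := PiNat.metricSpaceNatNat
  have key := PiNat.lipschitz_with_one_iff_forall_dist_image_le_of_mem_cylinder
    (E := fun _ => ℕ) (f := f)
  have h1 : f ∈ L ↔ ∀ x y : Baire, dist (f x) (f y) ≤ dist x y := by
    change LipschitzWith 1 f ↔ _
    rw [lipschitzWith_iff_dist_le_mul]
    simp
  rw [h1]
  refine key.trans ⟨fun h n x y hxy i hi => ?_, fun h x y n hxy => ?_⟩
  · have h2 := h y x n (PiNat.mem_cylinder_iff.2 fun i hi => hxy i hi)
    have h3 := PiNat.mem_cylinder_iff.1 (PiNat.mem_cylinder_iff_dist_le.2 h2) i hi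
    exact h3.symm
  · refine PiNat.mem_cylinder_iff_dist_le.1 (PiNat.mem_cylinder_iff.2 ?_)
    exact h n x y fun i hi => (PiNat.mem_cylinder_iff.1 hxy i hi).symm

lemma tail_mem_Lip : tail ∈ Lip := by
  refine mem_iUnion.2 ⟨1, ?_⟩
  let := PiNat.metricSpaceNatNat
  change LipschitzWith _ tail
  rw [lipschitzWith_iff_dist_le_mul]
  intro x y
  rcases eq_or_ne (tail x) (tail y) with h | h
  · rw [h, dist_self]
    positivity
  · have hxy : x ≠ y := fun e => h (by rw [e])
    have h1 : dist x y = (1 / 2 : ℝ) ^ PiNat.firstDiff x y := PiNat.dist_eq_of_ne hxy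
    have h2 : dist (tail x) (tail y) = (1 / 2 : ℝ) ^ PiNat.firstDiff (tail x) (tail y) :=
      PiNat.dist_eq_of_ne h
    have h3 : PiNat.firstDiff x y ≤ PiNat.firstDiff (tail x) (tail y) + 1 := by
      by_contra! h4
      have h5 : x (PiNat.firstDiff (tail x) (tail y) + 1) = y _ :=
        PiNat.apply_eq_of_lt_firstDiff h4
      exact PiNat.apply_firstDiff_ne h h5
    rw [h1, h2]
    have h5 : (1 / 2 : ℝ) ^ (PiNat.firstDiff (tail x) (tail y) + 1) ≤
        (1 / 2 : ℝ) ^ PiNat.firstDiff x y :=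
      pow_le_pow_of_le_one (by norm_num) (by norm_num) h3
    rw [pow_succ] at h5
    simp only [zpow_one, NNReal.coe_ofNat]
    linarith

lemma continuous_tail : Continuous tail :=
  continuous_pi fun n => continuous_apply (n + 1)

lemma continuous_cons (k : ℕ) : Continuous (cons k) := by
  refine continuous_pi fun n => ?_
  cases n with
  | zero => exact continuous_const
  | succ n => exact continuous_apply n

lemma id_mem_L : (fun x => x) ∈ L := mem_L_iff.2 fun _ _ _ h => h

lemma const_mem_L (c : Baire) : (fun _ => c) ∈ L := mem_L_iff.2 fun _ _ _ _ _ _ => rfl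

lemma cons_mem_L (k : ℕ) : cons k ∈ L := by
  refine mem_L_iff.2 fun n x y h i hi => ?_
  cases i with
  | zero => rfl
  | succ i => exact h i (by omega)

lemma comp_mem_L {f g : Baire → Baire} (hf : f ∈ L) (hg : g ∈ L) : f ∘ g ∈ L :=
  mem_L_iff.2 fun n x y h => mem_L_iff.1 hf n _ _ (mem_L_iff.1 hg n x y h)

lemma continuous_of_mem_L {f : Baire → Baire} (hf : f ∈ L) : Continuous f := by
  refine continuous_pi fun k => (IsLocallyConstant.iff_exists_open _).2 (fun x => ?_) |>.continuous
  refine ⟨PiNat.cylinder x (k + 1), PiNat.isOpen_cylinder _ x _, PiNat.self_mem_cylinder _ _, ?_⟩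
  intro y hy
  exact mem_L_iff.1 hf (k + 1) y x (fun i hi => PiNat.mem_cylinder_iff.1 hy i hi) k (by omega)

/-! ### Reducibility -/

lemma Red.compl {F : Set (Baire → Baire)} {A B : Set Baire} (h : Red F A B) : Red F Aᶜ Bᶜ := by
  obtain ⟨f, hf, rfl⟩ := h
  exact ⟨f, hf, rfl⟩

lemma Red.compl_left {F : Set (Baire → Baire)} {A B : Set Baire} (h : Red F A Bᶜ) :
    Red F Aᶜ B := by
  simpa using h.compl

lemma Red.compl_right {F : Set (Baire → Baire)} {A B : Set Baire} (h : Red F Aᶜ B) :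
    Red F A Bᶜ := by
  simpa using h.compl

lemma Red.mono {F G : Set (Baire → Baire)} (hFG : F ⊆ G) {A B : Set Baire} (h : Red F A B) :
    Red G A B := by
  obtain ⟨f, hf, e⟩ := h
  exact ⟨f, hFG hf, e⟩

lemma Red.trans_of_comp {F : Set (Baire → Baire)} (hF : ∀ f ∈ F, ∀ g ∈ F, f ∘ g ∈ F)
    {A B C : Set Baire} (h : Red F A B) (h' : Red F B C) : Red F A C := by
  obtain ⟨f, hf, rfl⟩ := h
  obtain ⟨g, hg, rfl⟩ := h'
  exact ⟨g ∘ f, hF g hg f hf, rfl⟩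

lemma Red.trans {A B C : Set Baire} (h : Red L A B) (h' : Red L B C) : Red L A C :=
  h.trans_of_comp (fun _ hf _ hg => comp_mem_L hf hg) h'

lemma Red.refl (A : Set Baire) : Red L A A := ⟨_, id_mem_L, rfl⟩

lemma loc_red (A : Set Baire) (k : ℕ) : Red L (loc A k) A := ⟨_, cons_mem_L k, rfl⟩

lemma red_shift (A : Set Baire) : Red L A (shift A) := ⟨_, cons_mem_L 0, rfl⟩

lemma Red.shift {A B : Set Baire} (h : Red L A B) : Red L (shift A) (shift B) := by
  obtain ⟨f, hf, rfl⟩ := h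
  refine ⟨fun x => cons 0 (f (tail x)), mem_L_iff.2 fun n x y h i hi => ?_, rfl⟩
  cases i with
  | zero => rfl
  | succ i => exact mem_L_iff.1 hf (i + 1) _ _ (fun j hj => h (j + 1) (by omega)) i (by omega)

lemma shift_loc_red (A : Set Baire) (k : ℕ) : Red L (WadgeHierarchy.shift (loc A k)) A := by
  refine ⟨fun x => cons k (tail x), mem_L_iff.2 fun n x y h i hi => ?_, rfl⟩
  cases i with
  | zero => rfl
  | succ i => exact h (i + 1) hi

/-- A 1-Lipschitz map may choose its strategy according to the first digit `k` of the input, and on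
inputs starting with `k` the sets `A` and `shift (loc A k)` agree. -/
lemma red_of_shift_loc {A B : Set Baire}
    (h : ∀ k, Red L (WadgeHierarchy.shift (loc A k)) B) : Red L A B := by
  choose f hf e using h
  refine ⟨fun x => f (x 0) x, mem_L_iff.2 fun n x y h i hi => ?_, ?_⟩
  · rw [h 0 (by omega)]
    exact mem_L_iff.1 (hf _) n x y h i hi
  · ext x
    have h1 : x ∈ WadgeHierarchy.shift (loc A (x 0)) ↔ f (x 0) x ∈ B := by
      conv_lhs => rw [e (x 0)]
      rfl
    rw [mem_preimage, ← h1]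
    simp [WadgeHierarchy.shift, loc]

lemma loc_red_of_red_shift {A B : Set Baire} (h : Red L A (WadgeHierarchy.shift B)) (k : ℕ) :
    Red L (loc A k) B := by
  obtain ⟨f, hf, rfl⟩ := h
  refine ⟨fun x => tail (f (cons k x)), mem_L_iff.2 fun n x y h i hi => ?_, rfl⟩
  refine mem_L_iff.1 hf (n + 1) _ _ (fun j hj => ?_) (i + 1) (by omega)
  cases j with
  | zero => rfl
  | succ j => exact h j (by omega)

lemma exists_loc_red_of_red {A B : Set Baire} (h : Red L A B) (k : ℕ) :
    ∃ j, Red L (loc A k) (loc B j) := by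
  obtain ⟨f, hf, rfl⟩ := h
  refine ⟨f (cons k 0) 0, fun x => tail (f (cons k x)), ?_, ?_⟩
  · refine mem_L_iff.2 fun n x y h i hi => ?_
    refine mem_L_iff.1 hf (n + 1) _ _ (fun j hj => ?_) (i + 1) (by omega)
    cases j with
    | zero => rfl
    | succ j => exact h j (by omega)
  · ext x
    have : f (cons k 0) 0 = f (cons k x) 0 := by
      refine mem_L_iff.1 hf 1 _ _ (fun j hj => ?_) 0 (by omega)
      obtain rfl : j = 0 := by omega
      rfl
    simp [loc, this]

/-- A selfdual set does not reduce to itself by a contraction. -/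
lemma Selfdual.not_shift_red {A : Set Baire} (h : Selfdual L A) :
    ¬ Red L (WadgeHierarchy.shift A) A := by
  intro h'
  obtain ⟨f, hf, e⟩ := h'.trans h
  obtain ⟨g, hg⟩ : ∃ g : Baire → Baire, g = fun x => f (cons 0 x) := ⟨_, rfl⟩
  have hA : ∀ x, x ∈ A ↔ g x ∉ A := fun x => by
    have h1 : cons 0 x ∈ WadgeHierarchy.shift A ↔ f (cons 0 x) ∈ Aᶜ := by
      conv_lhs => rw [e]
      rfl
    rw [hg]
    exact h1
  have hc : ∀ (n : ℕ) (x y : Baire), (∀ i < n, x i = y i) → ∀ i < n + 1, g x i = g y i := by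
    intro n x y h i hi
    rw [hg]
    refine mem_L_iff.1 hf (n + 1) _ _ (fun j hj => ?_) i hi
    cases j with
    | zero => rfl
    | succ j => exact h j (by omega)
  -- Since `g` gains a digit at each application, its iterates stabilise digit by digit to a fixed
  -- point; but `g` exchanges `A` and its complement.
  have hi : ∀ n m : ℕ, ∀ i < n, g^[n + m] 0 i = g^[n] 0 i := by
    intro n
    induction n with
    | zero => intro m i hi; omega
    | succ n ih =>
      intro m
      rw [show n + 1 + m = n + m + 1 by omega, Function.iterate_succ_apply',
        Function.iterate_succ_apply']
      exact hc n _ _ (ih m)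
  obtain ⟨x, hx⟩ : ∃ x : Baire, x = fun n => g^[n + 1] 0 n := ⟨_, rfl⟩
  have hxg : g x = x := by
    funext n
    have h1 : ∀ i < n, x i = g^[n] 0 i := fun i hin => by
      rw [hx]
      have := hi (i + 1) (n - (i + 1)) i (by omega)
      rw [show i + 1 + (n - (i + 1)) = n by omega] at this
      exact this.symm
    rw [hc n _ _ h1 n (by omega), hx]
    simp only [Function.iterate_succ_apply']
  have := hA x
  rw [hxg] at this
  tauto

/-! ### Flip systems -/

/-- The composition of the `n` functions `f m (z m)`, …, `f (m + n - 1) (z (m + n - 1))`. -/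
def iterComp (f : ℕ → Bool → Baire → Baire) (z : ℕ → Bool) : ℕ → ℕ → Baire → Baire
  | _, 0, p => p
  | m, n + 1, p => f m (z m) (iterComp f z (m + 1) n p)

lemma iterComp_add (f : ℕ → Bool → Baire → Baire) (z : ℕ → Bool) (m n k : ℕ) (p : Baire) :
    iterComp f z m (n + k) p = iterComp f z m n (iterComp f z (m + n) k p) := by
  induction n generalizing m with
  | zero => simp [iterComp]
  | succ n ih =>
    rw [show n + 1 + k = n + k + 1 by omega]
    simp only [iterComp]
    rw [ih, show m + 1 + n = m + (n + 1) by omega]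

lemma iterComp_congr (f : ℕ → Bool → Baire → Baire) {z z' : ℕ → Bool} (m n : ℕ)
    (h : ∀ j, m ≤ j → z j = z' j) (p : Baire) : iterComp f z m n p = iterComp f z' m n p := by
  induction n generalizing m with
  | zero => rfl
  | succ n ih =>
    simp only [iterComp]
    rw [ih (m + 1) fun j hj => h j (by omega), h m le_rfl]

lemma isLocallyConstant_iterComp (f : ℕ → Bool → Baire → Baire) (m n : ℕ) (p : Baire) :
    IsLocallyConstant fun z : ℕ → Bool => iterComp f z m n p := by
  induction n generalizing m with
  | zero => exact IsLocallyConstant.const p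
  | succ n ih =>
    exact ((IsLocallyConstant.iff_continuous _).2 (continuous_apply m)).comp₂ (ih (m + 1)) (f m)

/-- Makes sense of the infinite composition of the maps `π ∘ E m (z m)`. By `hconst` the values
before the last `π` converge, whatever the starting point. The closed graph of `E`, in place of
continuity, shows that the limits satisfy the recursion. The bound `N` does not depend on `z`, so
each coordinate of the limit is locally constant in `z`. -/
lemma exists_flip_limit (E : ℕ → Bool → Baire → Baire) (π : Baire → Baire) (hπ : Continuous π)
    (hE : ∀ m b, IsClosed {q : Baire × Baire | q.2 = E m b q.1})
    (hconst : ∀ m k, ∃ N, ∀ (z : ℕ → Bool) (p q : Baire),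
      E m (z m) (iterComp (fun m b => π ∘ E m b) z (m + 1) N p) k =
        E m (z m) (iterComp (fun m b => π ∘ E m b) z (m + 1) N q) k) :
    ∃ X : ℕ → (ℕ → Bool) → Baire,
      (∀ m z, X m z = π (E m (z m) (X (m + 1) z))) ∧
      (∀ m z z', (∀ j, m ≤ j → z j = z' j) → X m z = X m z') ∧ Continuous (X 0) := by
  obtain ⟨f, hf⟩ : ∃ f : ℕ → Bool → Baire → Baire, f = fun m b => π ∘ E m b := ⟨_, rfl⟩
  rw [← hf] at hconst
  have hf' : ∀ m b x, f m b x = π (E m b x) := fun m b x => by rw [hf]; rfl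
  choose N hN using hconst
  let w : ℕ → (ℕ → Bool) → Baire := fun m z k =>
    E m (z m) (iterComp f z (m + 1) (N m k) 0) k
  have hlim : ∀ m z, Filter.Tendsto (fun n => E m (z m) (iterComp f z (m + 1) n 0))
      Filter.atTop (nhds (w m z)) := by
    intro m z
    refine tendsto_pi_nhds.2 fun k => tendsto_const_nhds.congr' ?_
    filter_upwards [Filter.eventually_ge_atTop (N m k)] with n hn
    obtain ⟨j, rfl⟩ := Nat.exists_eq_add_of_le hn
    rw [iterComp_add]
    exact hN m k z _ _
  have hX : ∀ m z, Filter.Tendsto (fun n => iterComp f z m n 0) Filter.atTop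
      (nhds (π (w m z))) := by
    intro m z
    -- Dropping the empty composition exposes an outermost `π ∘ E m (z m)`.
    rw [← Filter.tendsto_add_atTop_iff_nat 1]
    simp only [iterComp, hf']
    exact (hπ.tendsto _).comp (hlim m z)
  refine ⟨fun m z => π (w m z), fun m z => ?_, fun m z z' h => ?_, ?_⟩
  · exact congrArg π ((hE m (z m)).mem_of_tendsto ((hX (m + 1) z).prodMk_nhds (hlim m z))
      (Filter.Eventually.of_forall fun n => rfl))
  · refine congrArg π (funext fun k => ?_)
    change E m (z m) (iterComp f z (m + 1) (N m k) 0) k =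
      E m (z' m) (iterComp f z' (m + 1) (N m k) 0) k
    rw [h m le_rfl, iterComp_congr f (m + 1) _ fun j hj => h j (by omega)]
  · refine hπ.comp (continuous_pi fun k => IsLocallyConstant.continuous ?_)
    exact ((IsLocallyConstant.iff_continuous _).2 (continuous_apply 0)).comp₂
      (isLocallyConstant_iterComp f 1 (N 0 k) 0) fun b x => E 0 b x k

lemma measurableSet_cantorSet : MeasurableSet cantorSet := by
  have : cantorSet = ⋂ n, {x : Baire | x n < 2} := by
    ext x
    simp [cantorSet]
  rw [this]
  exact MeasurableSet.iInter fun n => measurableSet_lt (measurable_pi_apply n) measurable_const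

/-- A system of reductions along which every coordinate gets determined yields a flip-set. -/
theorem false_of_flip_system {Γ : Set (Set Baire)} (hΓ : IsSelfdualBorPointclass Γ)
    (hFS : NoFlipSets Γ) {A : ℕ → Set Baire} (hA : A 0 ∈ Γ)
    (E : ℕ → Bool → Baire → Baire) (π : Baire → Baire) (hπ : Continuous π)
    (hE : ∀ m b, IsClosed {q : Baire × Baire | q.2 = E m b q.1})
    (hfalse : ∀ m x, π (E m false x) ∈ A m ↔ x ∈ A (m + 1))
    (htrue : ∀ m x, π (E m true x) ∈ A m ↔ x ∉ A (m + 1))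
    (hconst : ∀ m k, ∃ N, ∀ (z : ℕ → Bool) (p q : Baire),
      E m (z m) (iterComp (fun m b => π ∘ E m b) z (m + 1) N p) k =
        E m (z m) (iterComp (fun m b => π ∘ E m b) z (m + 1) N q) k) : False := by
  classical
  obtain ⟨X, hX, htail, hcont⟩ := exists_flip_limit E π hπ hE hconst
  obtain ⟨c, hc⟩ : ∃ c, c ∉ A 0 := by
    by_contra! h
    exact (htrue 0 0).1 (h _) ((hfalse 0 0).1 (h _))
  have hflip : ∀ (z z' : ℕ → Bool) (n : ℕ), z n ≠ z' n → (∀ j, j ≠ n → z j = z' j) →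
      (X 0 z ∈ A 0 ↔ X 0 z' ∉ A 0) := by
    intro z z' n hn hne
    -- Descending from `n` to `0`: beyond `n` the two limits coincide, at `n` one is sent through a
    -- reduction and the other through a complementing one, and below `n` both pass through the same
    -- map.
    have key : ∀ d m : ℕ, m + d = n → (X m z ∈ A m ↔ X m z' ∉ A m) := by
      intro d
      induction d with
      | zero =>
        rintro m rfl
        have e : X (m + 1) z = X (m + 1) z' := htail _ _ _ fun j hj => hne j (by omega)
        rw [hX m z, hX m z', e]
        simp only [add_zero] at hn
        cases hz : z m <;> cases hz' : z' m
        · exact absurd (hz.trans hz'.symm) hn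
        · rw [hfalse, htrue, not_not]
        · rw [hfalse, htrue]
        · exact absurd (hz.trans hz'.symm) hn
      | succ d ih =>
        intro m hm
        have h1 := ih (m + 1) (by omega)
        rw [hX m z, hX m z', ← hne m (by omega)]
        cases hz : z m
        · rw [hfalse, hfalse]; exact h1
        · rw [htrue, htrue]; tauto
    exact key n 0 (by omega)
  let dec : Baire → ℕ → Bool := fun x n => decide (x n ≠ 0)
  have hdec : Continuous dec := by
    refine continuous_pi fun n => ?_
    exact (continuous_of_discreteTopology (f := fun k : ℕ => decide (k ≠ 0))).comp
      (continuous_apply n)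
  -- The value `c ∉ A 0` keeps the preimage of `A 0` inside the Cantor set.
  let g : Baire → Baire := fun x => if x ∈ cantorSet then X 0 (dec x) else c
  have hg : Measurable g :=
    Measurable.ite measurableSet_cantorSet (hcont.comp hdec).measurable measurable_const
  have hgx : ∀ x ∈ cantorSet, (x ∈ g ⁻¹' A 0 ↔ X 0 (dec x) ∈ A 0) := fun x hx => by
    simp [g, hx]
  refine hFS _ (hΓ.preimage_mem _ hA g hg) ⟨fun x hx => ?_, ?_⟩
  · by_contra h
    simp only [g, mem_preimage, h, if_false] at hx
    exact hc hx
  · rintro x hx y hy ⟨n, hn, hu⟩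
    rw [hgx x hx, hgx y hy]
    refine hflip _ _ n ?_ fun j hj => ?_
    · have h1 := hx n
      have h2 := hy n
      simp only [dec, ne_eq, decide_eq_decide]
      omega
    · have : x j = y j := by
        by_contra h
        exact hj (hu j h)
      simp [dec, this]

/-- There is no sequence of sets, each of which reduces together with its complement to the
preceding one by contractions. -/
theorem false_of_contractions {Γ : Set (Set Baire)} (hΓ : IsSelfdualBorPointclass Γ)
    (hFS : NoFlipSets Γ) {A : ℕ → Set Baire} (hA : A 0 ∈ Γ)
    (h : ∀ n, Red L (shift (A (n + 1))) (A n)) (h' : ∀ n, Red L (shift (A (n + 1)))ᶜ (A n)) :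
    False := by
  choose f hf e using h
  choose f' hf' e' using h'
  let E : ℕ → Bool → Baire → Baire := fun n b x => (if b then f' n else f n) (cons 0 x)
  have hL : ∀ (n : ℕ) (b : Bool), (if b then f' n else f n) ∈ L := by
    intro n b
    cases b
    · simpa using hf n
    · simpa using hf' n
  have hc : ∀ n b (k : ℕ) (x y : Baire), (∀ i < k, x i = y i) →
      ∀ i < k + 1, E n b x i = E n b y i := by
    intro n b k x y hxy i hi
    refine mem_L_iff.1 (hL n b) (k + 1) _ _ (fun j hj => ?_) i hi
    cases j with
    | zero => rfl
    | succ j => exact hxy j (by omega)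
  have hit : ∀ (z : ℕ → Bool) (n m : ℕ) (p q : Baire), ∀ i < n,
      iterComp E z m n p i = iterComp E z m n q i := by
    intro z n
    induction n with
    | zero => intro m p q i hi; omega
    | succ n ih => intro m p q; exact hc _ _ n _ _ (ih (m + 1) p q)
  -- The `k` inner contractions settle the digits below `k`, and the outer one settles digit `k`.
  refine false_of_flip_system hΓ hFS hA E id continuous_id (fun m b => ?_) (fun m x => ?_)
    (fun m x => ?_) fun m k => ⟨k, fun z p q => ?_⟩
  · exact isClosed_eq continuous_snd
      (((continuous_of_mem_L (hL m b)).comp (continuous_cons 0)).comp continuous_fst)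
  · have : cons 0 x ∈ shift (A (m + 1)) ↔ f m (cons 0 x) ∈ A m := by
      conv_lhs => rw [e m]
      rfl
    exact this.symm
  · have : cons 0 x ∈ (shift (A (m + 1)))ᶜ ↔ f' m (cons 0 x) ∈ A m := by
      conv_lhs => rw [e' m]
      rfl
    exact this.symm
  · exact hc m (z m) k _ _ (hit z k (m + 1) p q) k (by omega)

/-! ### The Lipschitz hierarchy -/

section Lipschitz

variable {Γ : Set (Set Baire)}

lemma shift_mem (hΓ : IsSelfdualBorPointclass Γ) {A : Set Baire} (hA : A ∈ Γ) : shift A ∈ Γ :=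
  hΓ.preimage_mem A hA tail continuous_tail.measurable

lemma loc_mem (hΓ : IsSelfdualBorPointclass Γ) {A : Set Baire} (hA : A ∈ Γ) (k : ℕ) :
    loc A k ∈ Γ :=
  hΓ.preimage_mem A hA (cons k) (continuous_cons k).measurable

lemma SRed.compl_red {F : Set (Baire → Baire)} (hSLO : SLO F Γ) {A B : Set Baire} (hA : A ∈ Γ)
    (hB : B ∈ Γ) (h : SRed F A B) : Red F Aᶜ B :=
  (hSLO B hB A hA).resolve_left h.2

/-- `B <_L A`, and moreover `B` reduces to `A` by a contraction. -/
def ContractionBelow (Γ : Set (Set Baire)) (B A : Set Baire) : Prop :=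
  B ∈ Γ ∧ A ∈ Γ ∧ SRed L B A ∧ Red L (shift B) A

/-- The Martin–Monk argument, on every second term of a descending chain: of two consecutive steps
one, being strict, reduces both the set and its complement, and the other makes these reductions
contractions. -/
lemma wellFounded_contractionBelow (hΓ : IsSelfdualBorPointclass Γ) (hSLO : SLO L Γ)
    (hFS : NoFlipSets Γ) : WellFounded (ContractionBelow Γ) := by
  refine wellFounded_iff_isEmpty_descending_chain.2 ⟨fun ⟨s, hs⟩ => ?_⟩
  refine false_of_contractions hΓ hFS (A := fun n => s (2 * n)) (hs 0).2.1 (fun n => ?_) fun n => ?_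
  · exact (hs (2 * n + 1)).2.2.1.1.shift.trans (hs (2 * n)).2.2.2
  · have h1 := (hs (2 * n + 1)).2.2.1.compl_red hSLO (hs (2 * n + 1)).1 (hs (2 * n + 1)).2.1
    exact h1.shift.trans (hs (2 * n)).2.2.2

/-- A nonselfdual set reduces to one of its localizations. -/
theorem exists_red_loc (hΓ : IsSelfdualBorPointclass Γ) (hSLO : SLO L Γ) (hFS : NoFlipSets Γ)
    {A : Set Baire} (hA : A ∈ Γ) (hns : ¬ Selfdual L A) : ∃ k, Red L A (loc A k) := by
  induction A using (wellFounded_contractionBelow hΓ hSLO hFS).induction with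
  | _ A ih =>
  by_contra! hno
  obtain ⟨k, hk⟩ : ∃ k, ¬ Red L (shift (loc Aᶜ k)) A := by
    by_contra! h
    exact hns (red_of_shift_loc h).compl_right
  have hkΓ := loc_mem hΓ hA k
  -- With `shift_loc_red`, `A` becomes `L`-equivalent to `shift (loc A k)`, so `loc A k` inherits
  -- nonselfduality and the induction hypothesis applies to it.
  have h1 : Red L A (shift (loc A k)) := by
    have h2 : Red L Aᶜ (shift (loc A k))ᶜ :=
      (hSLO _ (shift_mem hΓ (loc_mem hΓ (hΓ.compl_mem A hA) k)) A hA).resolve_left hk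
    simpa using h2.compl
  have h3 : ¬ Selfdual L (loc A k) := fun h => by
    have h4 : Red L (shift (loc A k))ᶜ (shift (loc A k)) := (Red.compl_left h).shift
    have h5 : Red L Aᶜ A := (h1.compl.trans h4).trans (shift_loc_red A k)
    exact hns h5.compl_right
  obtain ⟨j, hj⟩ := ih (loc A k) ⟨hkΓ, hA, ⟨loc_red A k, hno k⟩, shift_loc_red A k⟩ hkΓ h3
  -- The move `j` available inside `loc A k` absorbs the digit ignored by the shift, giving `A ≤_L
  -- loc A k`.
  exact hno k (h1.trans (hj.shift.trans (shift_loc_red _ j)))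

lemma shift_red_of_not_selfdual (hΓ : IsSelfdualBorPointclass Γ) (hSLO : SLO L Γ)
    (hFS : NoFlipSets Γ) {A : Set Baire} (hA : A ∈ Γ) (hns : ¬ Selfdual L A) :
    Red L (shift A) A := by
  obtain ⟨k, hk⟩ := exists_red_loc hΓ hSLO hFS hA hns
  exact hk.shift.trans (shift_loc_red A k)

lemma Selfdual.shift_compl_red {A : Set Baire} (h : Selfdual L A) :
    Red L (shift A)ᶜ (shift A) :=
  (Red.compl_left h).shift

/-- The descent step: `D < E < shift D` yields `C < D < shift C` with `C` a localization of `E`. Not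
all `shift (loc E k)` reduce to `D`, or `E` would; a bad `k` gives a selfdual `C`, since a
nonselfdual one would absorb the shift. -/
lemma exists_loc_of_between (hΓ : IsSelfdualBorPointclass Γ) (hSLO : SLO L Γ)
    (hFS : NoFlipSets Γ) {D E : Set Baire} (hD : D ∈ Γ) (hE : E ∈ Γ)
    (h : SRed L D E) (h' : SRed L E (shift D)) :
    ∃ C ∈ Γ, Selfdual L C ∧ SRed L C D ∧ SRed L D (shift C) ∧ ContractionBelow Γ C E := by
  obtain ⟨k, hk⟩ : ∃ k, ¬ Red L (shift (loc E k)) D := by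
    by_contra! hall
    exact h.2 (red_of_shift_loc hall)
  have hC := loc_mem hΓ hE k
  have hCD : Red L (loc E k) D := loc_red_of_red_shift h'.1 k
  have hself : Selfdual L (loc E k) := by
    by_contra hns
    exact hk ((shift_red_of_not_selfdual hΓ hSLO hFS hC hns).trans hCD)
  have hDC : Red L D (shift (loc E k)) :=
    ((hSLO _ (shift_mem hΓ hC) D hD).resolve_left hk).compl_right.trans
      hself.shift_compl_red
  refine ⟨loc E k, hC, hself, ⟨hCD, fun hc => ?_⟩, ⟨hDC, hk⟩, hC, hE,
    ⟨loc_red E k, fun hc => h.2 (hc.trans hCD)⟩, shift_loc_red E k⟩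
  exact h'.2 (hc.shift.trans (shift_loc_red E k))

/-- Nothing lies strictly between a selfdual set and its shift. -/
lemma not_between_shift (hΓ : IsSelfdualBorPointclass Γ) (hSLO : SLO L Γ) (hFS : NoFlipSets Γ)
    {E : Set Baire} (hE : E ∈ Γ) : ∀ D ∈ Γ, SRed L D E → ¬ SRed L E (shift D) := by
  induction E using (wellFounded_contractionBelow hΓ hSLO hFS).induction with
  | _ E ih =>
  intro D hD h h'
  -- Two descents are needed for the middle set `E` to be replaced by `C`, which lies below it by a
  -- contraction.
  obtain ⟨C, hC, -, hCD, hDC, hCE⟩ := exists_loc_of_between hΓ hSLO hFS hD hE h h'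
  obtain ⟨B, hB, -, hBC, hCB, -⟩ := exists_loc_of_between hΓ hSLO hFS hC hD hCD hDC
  exact ih C hCE hC B hB hBC hCB

/-- A set reduces by a contraction to every set strictly above it. -/
theorem SRed.shift_red (hΓ : IsSelfdualBorPointclass Γ) (hSLO : SLO L Γ) (hFS : NoFlipSets Γ)
    {D E : Set Baire} (hD : D ∈ Γ) (hE : E ∈ Γ) (h : SRed L D E) : Red L (shift D) E := by
  by_cases hs : Selfdual L D
  · by_contra hn
    refine not_between_shift hΓ hSLO hFS hE D hD h ⟨?_, hn⟩
    have h1 := (hSLO _ (shift_mem hΓ hD) E hE).resolve_left hn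
    exact h1.compl_right.trans hs.shift_compl_red
  · exact (shift_red_of_not_selfdual hΓ hSLO hFS hD hs).trans h.1

/-- The Lipschitz hierarchy is well-founded. -/
theorem wellFounded_sRed (hΓ : IsSelfdualBorPointclass Γ) (hSLO : SLO L Γ) (hFS : NoFlipSets Γ) :
    WellFounded fun B A => B ∈ Γ ∧ A ∈ Γ ∧ SRed L B A :=
  Subrelation.wf (fun {_ _} h => ⟨h.1, h.2.1, h.2.2, h.2.2.shift_red hΓ hSLO hFS h.1 h.2.1⟩)
    (wellFounded_contractionBelow hΓ hSLO hFS)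

end Lipschitz

/-! ### The characteristic set -/

section CharSet

variable {F : Set (Baire → Baire)}

lemma IsBorelAmenable.mem_of_mem_L (hF : IsBorelAmenable F) {f : Baire → Baire} (hf : f ∈ L) :
    f ∈ F :=
  hF.L_subset hf

lemma IsBorelAmenable.const_mem (hF : IsBorelAmenable F) (c : Baire) : (fun _ => c) ∈ F :=
  hF.L_subset (const_mem_L c)

lemma IsBorelAmenable.tail_mem (hF : IsBorelAmenable F) : tail ∈ F := hF.Lip_subset tail_mem_Lip

lemma IsBorelAmenable.red_trans (hF : IsBorelAmenable F) {A B C : Set Baire} (h : Red F A B)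
    (h' : Red F B C) : Red F A C :=
  h.trans_of_comp hF.comp_mem h'

lemma IsBorelAmenable.red_refl (hF : IsBorelAmenable F) (A : Set Baire) : Red F A A :=
  (Red.refl A).mono hF.L_subset

lemma IsBorelAmenable.red_of_red_L (hF : IsBorelAmenable F) {A B : Set Baire} (h : Red L A B) :
    Red F A B :=
  h.mono hF.L_subset

lemma IsBorelAmenable.preimage_mem_charSet (hF : IsBorelAmenable F) {f : Baire → Baire}
    (hf : f ∈ F) {D : Set Baire} (hD : D ∈ charSet F) : f ⁻¹' D ∈ charSet F :=
  hF.red_trans ⟨f, hf, rfl⟩ hD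

lemma IsBorelAmenable.mem_charSet_of_red (hF : IsBorelAmenable F) {A B : Set Baire}
    (h : Red F A B) (hB : B ∈ charSet F) : A ∈ charSet F :=
  hF.red_trans h hB

lemma IsBorelAmenable.empty_mem_charSet (hF : IsBorelAmenable F) : ∅ ∈ charSet F :=
  ⟨fun _ _ => 1, hF.const_mem _, by ext; simp⟩

lemma IsBorelAmenable.univ_mem_charSet (hF : IsBorelAmenable F) : univ ∈ charSet F :=
  ⟨fun _ _ => 0, hF.const_mem _, by ext; simp⟩

lemma IsBorelAmenable.setOf_zero_mem_charSet (hF : IsBorelAmenable F) (i : ℕ) :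
    {x : Baire | x 0 = i} ∈ charSet F := by
  refine ⟨fun x _ => if x 0 = i then 0 else 1, hF.mem_of_mem_L (mem_L_iff.2 fun n x y h j hj => ?_),
    ?_⟩
  · rw [h 0 (by omega)]
  · ext x
    simp

lemma IsBorelAmenable.setOf_apply_mem_charSet (hF : IsBorelAmenable F) (n i : ℕ) :
    {x : Baire | x n = i} ∈ charSet F := by
  induction n with
  | zero => exact hF.setOf_zero_mem_charSet i
  | succ n ih => exact hF.preimage_mem_charSet hF.tail_mem ih

/-- Functions in `F` can be glued along the fibres of a function into `ℕ`. -/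
lemma IsBorelAmenable.glue (hF : IsBorelAmenable F) {p : Baire → ℕ}
    (hp : ∀ i, {x | p x = i} ∈ charSet F) {f : ℕ → Baire → Baire} (hf : ∀ n, f n ∈ F) :
    (fun x => f (p x) x) ∈ F := by
  refine hF.glue_mem (fun i => {x | p x = i}) ⟨hp, fun m n hmn => ?_, ?_⟩ f hf _ fun n x hx => ?_
  · exact disjoint_left.2 fun x hx hx' => hmn (hx.symm.trans hx')
  · exact eq_univ_of_forall fun x => mem_iUnion.2 ⟨p x, rfl⟩
  · rw [show p x = n from hx]

lemma IsBorelAmenable.setOf_mem_apply_mem_charSet (hF : IsBorelAmenable F) {p : Baire → ℕ}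
    (hp : ∀ i, {x | p x = i} ∈ charSet F) {E : ℕ → Set Baire} (hE : ∀ n, E n ∈ charSet F) :
    {x | x ∈ E (p x)} ∈ charSet F := by
  choose f hf e using hE
  refine ⟨_, hF.glue hp hf, ?_⟩
  ext x
  change x ∈ E (p x) ↔ f (p x) x 0 = 0
  conv_lhs => rw [e (p x)]
  rfl

/-- The first coordinate of a reduction has all its fibres in `Δ_F`, which provides a partition for
`glue`; the Boolean closure of `Δ_F` follows. -/
lemma IsBorelAmenable.exists_fibres (hF : IsBorelAmenable F) {D : Set Baire}
    (hD : D ∈ charSet F) :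
    ∃ p : Baire → ℕ, (∀ i, {x | p x = i} ∈ charSet F) ∧ D = {x | p x = 0} := by
  obtain ⟨f, hf, rfl⟩ := hD
  exact ⟨fun x => f x 0, fun i => hF.preimage_mem_charSet hf (hF.setOf_zero_mem_charSet i), rfl⟩

lemma IsBorelAmenable.setOf_apply_mem_mem_charSet (hF : IsBorelAmenable F) {p : Baire → ℕ}
    (hp : ∀ i, {x | p x = i} ∈ charSet F) (S : Set ℕ) : {x | p x ∈ S} ∈ charSet F := by
  classical
  have := hF.setOf_mem_apply_mem_charSet hp (E := fun n => if n ∈ S then univ else ∅) fun n => by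
    split_ifs
    exacts [hF.univ_mem_charSet, hF.empty_mem_charSet]
  convert this using 1
  ext x
  by_cases h : p x ∈ S <;> simp [h]

lemma IsBorelAmenable.compl_mem_charSet (hF : IsBorelAmenable F) {D : Set Baire}
    (hD : D ∈ charSet F) : Dᶜ ∈ charSet F := by
  obtain ⟨p, hp, rfl⟩ := hF.exists_fibres hD
  exact hF.setOf_apply_mem_mem_charSet hp {0}ᶜ

lemma IsBorelAmenable.inter_mem_charSet (hF : IsBorelAmenable F) {D D' : Set Baire}
    (hD : D ∈ charSet F) (hD' : D' ∈ charSet F) : D ∩ D' ∈ charSet F := by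
  obtain ⟨p, hp, rfl⟩ := hF.exists_fibres hD
  have := hF.setOf_mem_apply_mem_charSet hp (E := fun n => if n = 0 then D' else ∅) fun n => by
    split_ifs
    exacts [hD', hF.empty_mem_charSet]
  convert this using 1
  ext x
  by_cases h : p x = 0 <;> simp [h]

open Classical in
lemma IsBorelAmenable.ite_mem (hF : IsBorelAmenable F) {D : Set Baire} (hD : D ∈ charSet F)
    {f g : Baire → Baire} (hf : f ∈ F) (hg : g ∈ F) :
    (fun x => if x ∈ D then f x else g x) ∈ F := by
  obtain ⟨p, hp, rfl⟩ := hF.exists_fibres hD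
  have := hF.glue hp (f := fun n => if n = 0 then f else g) fun n => by
    split_ifs
    exacts [hf, hg]
  convert this using 2 with x
  by_cases h : p x = 0 <;> simp [h]

lemma IsBorelAmenable.inter_red (hF : IsBorelAmenable F) {A D : Set Baire} (hA : A ≠ univ)
    (hD : D ∈ charSet F) : Red F (D ∩ A) A := by
  classical
  obtain ⟨c, hc⟩ := (ne_univ_iff_exists_notMem A).1 hA
  refine ⟨_, hF.ite_mem hD (hF.mem_of_mem_L id_mem_L) (hF.const_mem c), ?_⟩
  ext x
  by_cases h : x ∈ D <;> simp [h, hc]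

lemma IsBorelAmenable.measurableSet_of_mem_charSet (hF : IsBorelAmenable F) {D : Set Baire}
    (hD : D ∈ charSet F) : MeasurableSet D := by
  obtain ⟨f, hf, rfl⟩ := hD
  have hm : Measurable f := hF.subset_Bor hf
  exact hm (measurable_pi_apply 0 (measurableSet_singleton 0))

/-- All coordinates of `h` have their fibres in the characteristic set. -/
def HasFibres (F : Set (Baire → Baire)) (h : Baire → Baire) : Prop :=
  ∀ k i, {x | h x k = i} ∈ charSet F

lemma IsBorelAmenable.hasFibres (hF : IsBorelAmenable F) {f : Baire → Baire} (hf : f ∈ F) :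
    HasFibres F f := fun k i =>
  hF.preimage_mem_charSet hf (hF.setOf_apply_mem_charSet k i)

lemma HasFibres.comp (hF : IsBorelAmenable F) {h f : Baire → Baire} (hh : HasFibres F h)
    (hf : f ∈ F) : HasFibres F (h ∘ f) := fun k i =>
  hF.preimage_mem_charSet hf (hh k i)

/-! ### Change of topology within the characteristic set -/

/-- `h` has fibres in the characteristic set of `F`, and its graph is closed. The topology
generated by such an `h` is Polish, and has a basis from the characteristic set. -/
structure Resolves (F : Set (Baire → Baire)) (h : Baire → Baire) : Prop where
  hasFibres : HasFibres F h
  isClosed : IsClosed {q : Baire × Baire | q.2 = h q.1}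

/-- `D` becomes clopen in a finer Polish topology with a basis from the characteristic set. -/
def Resolvable (F : Set (Baire → Baire)) (D : Set Baire) : Prop :=
  ∃ h, Resolves F h ∧ ∃ S : Set ℕ, D = {x | h x 0 ∈ S}

/-- The `c`-th of the sequences coded by `y`. -/
def slice (c : ℕ) (y : Baire) : Baire := fun i => y (Nat.pair c i)

lemma continuous_slice (c : ℕ) : Continuous (slice c) :=
  continuous_pi fun _ => continuous_apply _

/-- If the graph of `h` is closed modulo countably many resolving functions, then `h` is a
continuous image of a resolving function. -/
lemma exists_resolves {h : Baire → Baire} (hh : HasFibres F h) {e : ℕ → Baire → Baire}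
    (he : ∀ c, Resolves F (e c)) {T : Set (Baire × (ℕ → Baire))} (hT : IsClosed T)
    (hTh : ∀ x v, (v, fun c => e c x) ∈ T ↔ v = h x) :
    ∃ E, Resolves F E ∧ ∀ x, slice 0 (E x) = h x := by
  -- `E` interleaves `h`, as slice `0`, with the maps `e c`, as slices `c + 1`. Its graph is cut out
  -- by the closed graphs of the `e c` and the closed relation `T`.
  let u : ℕ → Baire → Baire := fun c => Nat.casesOn c h e
  let E : Baire → Baire := fun x j => u (Nat.unpair j).1 x (Nat.unpair j).2
  have hs : ∀ c x, slice c (E x) = u c x := fun c x => by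
    funext i
    simp [slice, E]
  have hu : ∀ c, HasFibres F (u c) := fun c => by
    cases c with
    | zero => exact hh
    | succ c => exact (he c).hasFibres
  refine ⟨E, ⟨fun j i => hu _ _ i, ?_⟩, hs 0⟩
  have : {q : Baire × Baire | q.2 = E q.1} =
      (⋂ c, (fun q : Baire × Baire => (q.1, slice (c + 1) q.2)) ⁻¹' {q | q.2 = e c q.1}) ∩
        (fun q : Baire × Baire => (slice 0 q.2, fun c => slice (c + 1) q.2)) ⁻¹' T := by
    ext ⟨x, y⟩
    simp only [mem_ofPred_eq, mem_inter_iff, mem_iInter, mem_preimage]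
    constructor
    · rintro rfl
      have h1 : ∀ c, slice (c + 1) (E x) = e c x := fun c => hs (c + 1) x
      refine ⟨h1, ?_⟩
      simp only [h1]
      exact (hTh x _).2 (hs 0 x)
    · rintro ⟨h1, h2⟩
      simp only [h1] at h2
      have h3 := (hTh x _).1 h2
      funext j
      change y j = u (Nat.unpair j).1 x (Nat.unpair j).2
      rw [show y j = slice (Nat.unpair j).1 y (Nat.unpair j).2 by simp [slice]]
      refine congrFun ?_ _
      cases (Nat.unpair j).1 with
      | zero => exact h3
      | succ c => exact h1 c
  rw [this]
  refine (isClosed_iInter fun c => (he c).isClosed.preimage ?_).inter (hT.preimage ?_)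
  · exact continuous_fst.prodMk ((continuous_slice _).comp continuous_snd)
  · exact ((continuous_slice 0).comp continuous_snd).prodMk
      (continuous_pi fun c => (continuous_slice _).comp continuous_snd)

lemma Resolvable.mem_charSet (hF : IsBorelAmenable F) {D : Set Baire} (h : Resolvable F D) :
    D ∈ charSet F := by
  obtain ⟨e, he, S, rfl⟩ := h
  exact hF.setOf_apply_mem_mem_charSet (he.hasFibres 0) S

lemma Resolvable.compl {D : Set Baire} (h : Resolvable F D) : Resolvable F Dᶜ := by
  obtain ⟨e, he, S, rfl⟩ := h
  exact ⟨e, he, Sᶜ, rfl⟩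

lemma Resolvable.preimage (hF : IsBorelAmenable F) {D : Set Baire} (h : Resolvable F D)
    {g : Baire → Baire} (hg : g ∈ L) : Resolvable F (g ⁻¹' D) := by
  obtain ⟨e, he, S, rfl⟩ := h
  refine ⟨e ∘ g, ⟨he.hasFibres.comp hF (hF.mem_of_mem_L hg), ?_⟩, S, rfl⟩
  exact he.isClosed.preimage
    (((continuous_of_mem_L hg).comp continuous_fst).prodMk continuous_snd)

lemma resolvable_apply_mem (hF : IsBorelAmenable F) (n : ℕ) (S : Set ℕ) :
    Resolvable F {x : Baire | x n ∈ S} := by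
  refine ⟨fun x j => x (n + j), ⟨fun k i => hF.setOf_apply_mem_charSet (n + k) i, ?_⟩, S, rfl⟩
  exact isClosed_eq continuous_snd (continuous_pi fun j => (continuous_apply _).comp continuous_fst)

lemma Resolvable.iUnion (hF : IsBorelAmenable F) {D : ℕ → Set Baire}
    (h : ∀ n, Resolvable F (D n)) (hD : ⋃ n, D n ∈ charSet F) : Resolvable F (⋃ n, D n) := by
  classical
  have hDn := fun n => (h n).mem_charSet hF
  choose e he S hS using h
  -- `p` is one plus the least index of a `D k` containing the point, and `0` off the union. Once
  -- every `D k` is clopen, each clause on the right is a closed condition.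
  obtain ⟨p, hp⟩ : ∃ p : Baire → ℕ, ∀ x m, p x = m ↔
      ∀ k, (m = 0 → x ∉ D k) ∧ (m = k + 1 → x ∈ D k ∧ ∀ j < k, x ∉ D j) := by
    refine ⟨fun x => if hx : ∃ k, x ∈ D k then Nat.find hx + 1 else 0, fun x m => ?_⟩
    beta_reduce
    split_ifs with hx
    · cases m with
      | zero => simpa using hx
      | succ m => simp [Nat.find_eq_iff]
    · push Not at hx
      cases m with
      | zero => simp [hx]
      | succ m => simp [hx]
  have hdisj : ∀ k, disjointed D k ∈ charSet F := fun k =>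
    disjointedRec (p := (· ∈ charSet F))
      (fun {t i} ht => hF.inter_mem_charSet ht (hF.compl_mem_charSet (hDn i))) (hDn k)
  have hpf : HasFibres F fun x _ => p x := fun _ i => by
    cases i with
    -- Only this fibre, the complement of the union, needs the hypothesis that the union is in
    -- `Δ_F`.
    | zero =>
      convert hF.compl_mem_charSet hD using 1
      ext x
      simp [hp]
    | succ k =>
      convert hdisj k using 1
      ext x
      simp [hp, disjointed_eq_inter_compl]
  have hT : IsClosed {w : Baire × (ℕ → Baire) | (∀ n, w.1 n = w.1 0) ∧
      ∀ k, (w.1 0 = 0 → w.2 k 0 ∉ S k) ∧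
        (w.1 0 = k + 1 → w.2 k 0 ∈ S k ∧ ∀ j < k, w.2 j 0 ∉ S j)} := by
    have hc1 : ∀ n, Continuous fun w : Baire × (ℕ → Baire) => w.1 n := fun n =>
      (continuous_apply n).comp continuous_fst
    have hc2 : ∀ k, Continuous fun w : Baire × (ℕ → Baire) => w.2 k 0 := fun k =>
      (continuous_apply 0).comp ((continuous_apply k).comp continuous_snd)
    have hclo : ∀ (P : ℕ → ℕ → Prop) (k : ℕ),
        IsClosed {w : Baire × (ℕ → Baire) | P (w.1 0) (w.2 k 0)} := fun P k =>
      (isClosed_discrete {r : ℕ × ℕ | P r.1 r.2}).preimage ((hc1 0).prodMk (hc2 k))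
    simp only [ofPred_and, ofPred_forall]
    refine (isClosed_iInter fun n => isClosed_eq (hc1 n) (hc1 0)).inter
      (isClosed_iInter fun k => (hclo (fun a b => a = 0 → b ∉ S k) k).inter ?_)
    have : {w : Baire × (ℕ → Baire) | w.1 0 = k + 1 → w.2 k 0 ∈ S k ∧ ∀ j < k, w.2 j 0 ∉ S j} =
        {w | w.1 0 = k + 1 → w.2 k 0 ∈ S k} ∩
          ⋂ j, {w | w.1 0 = k + 1 → j < k → w.2 j 0 ∉ S j} := by
      ext w
      simp only [mem_ofPred_eq, mem_inter_iff, mem_iInter]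
      tauto
    rw [this]
    exact (hclo (fun a b => a = k + 1 → b ∈ S k) k).inter
      (isClosed_iInter fun j => hclo (fun a b => a = k + 1 → j < k → b ∉ S j) j)
  obtain ⟨E, hE, hEp⟩ : ∃ E, Resolves F E ∧ ∀ x, slice 0 (E x) = fun _ => p x := by
    refine exists_resolves hpf he hT fun x v => ?_
    have hmem : ∀ k, e k x 0 ∈ S k ↔ x ∈ D k := fun k => by
      conv_rhs => rw [hS k]
      rfl
    simp only [mem_ofPred_eq, hmem]
    rw [← hp x (v 0)]
    constructor
    · rintro ⟨h1, h2⟩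
      funext n
      rw [h1 n, h2]
    · rintro rfl
      exact ⟨fun _ => rfl, rfl⟩
  refine ⟨E, hE, {0}ᶜ, ?_⟩
  ext x
  have h0 : E x 0 = p x := congrFun (hEp x) 0
  simp only [mem_iUnion, mem_ofPred_eq, h0, mem_compl_iff, mem_singleton_iff, hp]
  simp

/-- Makes the ordering principle available for all Borel sets. -/
lemma mem_of_measurableSet {Γ : Set (Set Baire)} (hΓ : IsSelfdualBorPointclass Γ) {A : Set Baire}
    (hA : A ∈ Γ) (hne : A.Nonempty) (huniv : A ≠ univ) {H : Set Baire} (hH : MeasurableSet H) :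
    H ∈ Γ := by
  classical
  obtain ⟨a, ha⟩ := hne
  obtain ⟨b, hb⟩ := (ne_univ_iff_exists_notMem A).1 huniv
  have h := hΓ.preimage_mem A hA (fun x => if x ∈ H then a else b)
    (Measurable.ite hH measurable_const measurable_const)
  convert h using 1
  ext x
  by_cases hx : x ∈ H <;> simp [hx, ha, hb]

/-- All sets in the characteristic set are resolvable: otherwise the resolvable sets form a
σ-algebra by the ordering principle, and then all Borel sets are resolvable. -/
theorem resolvable_of_mem_charSet (hF : IsBorelAmenable F)
    (hSLO : ∀ A B : Set Baire, MeasurableSet A → MeasurableSet B → Red L A B ∨ Red L Bᶜ A)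
    {D : Set Baire} (hD : D ∈ charSet F) : Resolvable F D := by
  by_contra hDR
  let m : MeasurableSpace Baire :=
    { MeasurableSet' := Resolvable F
      measurableSet_empty := by simpa using resolvable_apply_mem hF 0 ∅
      measurableSet_compl := fun _ h => h.compl
      measurableSet_iUnion := fun E hE => by
        by_cases hH : ⋃ n, E n ∈ charSet F
        · exact Resolvable.iUnion hF hE hH
        · refine absurd ?_ hDR
          have hHm := MeasurableSet.iUnion fun n =>
            hF.measurableSet_of_mem_charSet ((hE n).mem_charSet hF)
          -- A union outside `Δ_F` cannot reduce to `D`, so `Dᶜ` reduces to it. Then `Dᶜ` is a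
          -- countable union of resolvable sets which does lie in `Δ_F`, and `D` would be
          -- resolvable.
          rcases hSLO _ D hHm (hF.measurableSet_of_mem_charSet hD) with h | h
          · exact absurd (hF.mem_charSet_of_red (hF.red_of_red_L h) hD) hH
          · obtain ⟨g, hg, e⟩ := h
            rw [preimage_iUnion] at e
            have h1 := Resolvable.iUnion hF (fun n => (hE n).preimage hF hg)
              (e ▸ hF.compl_mem_charSet hD)
            rw [← e] at h1
            simpa using h1.compl }
  have hle : MeasurableSpace.pi ≤ m := by
    refine iSup_le fun n => ?_
    rintro _ ⟨S, -, rfl⟩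
    exact resolvable_apply_mem hF n S
  exact hDR (hle _ (hF.measurableSet_of_mem_charSet hD))

/-- Every function in `F` is a continuous image of a function with closed graph, whose fibres are
in the characteristic set. -/
theorem IsBorelAmenable.exists_resolves_of_mem (hF : IsBorelAmenable F)
    (hSLO : ∀ A B : Set Baire, MeasurableSet A → MeasurableSet B → Red L A B ∨ Red L Bᶜ A)
    {f : Baire → Baire} (hf : f ∈ F) : ∃ E, Resolves F E ∧ ∀ x, slice 0 (E x) = f x := by
  have h := fun c : ℕ => resolvable_of_mem_charSet hF hSLO
    (hF.hasFibres hf (Nat.unpair c).1 (Nat.unpair c).2)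
  choose e he S hS using h
  -- The index `c` codes a pair `(k, i)`, and `e c` decides whether `f x k = i`; together these
  -- determine `f x` by closed conditions.
  refine exists_resolves (hF.hasFibres hf) he
    (T := ⋂ c : ℕ, {w | w.1 (Nat.unpair c).1 = (Nat.unpair c).2 ↔ w.2 c 0 ∈ S c}) ?_ ?_
  · refine isClosed_iInter fun c => ?_
    have hc : Continuous fun w : Baire × (ℕ → Baire) => (w.1 (Nat.unpair c).1, w.2 c 0) :=
      ((continuous_apply _).comp continuous_fst).prodMk
        ((continuous_apply 0).comp ((continuous_apply c).comp continuous_snd))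
    exact (isClosed_discrete {r : ℕ × ℕ | r.1 = (Nat.unpair c).2 ↔ r.2 ∈ S c}).preimage hc
  · intro x v
    have hmem : ∀ c, e c x 0 ∈ S c ↔ f x (Nat.unpair c).1 = (Nat.unpair c).2 := fun c => by
      have : x ∈ {x | f x (Nat.unpair c).1 = (Nat.unpair c).2} ↔ x ∈ {x | e c x 0 ∈ S c} := by
        rw [← hS c]
      exact this.symm
    simp only [mem_iInter, mem_ofPred_eq, hmem]
    constructor
    · intro h
      funext k
      have := h (Nat.pair k (f x k))
      simpa using this
    · rintro rfl c
      rfl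

end CharSet

/-! ### Selfdual sets have the decomposition property -/

section Decomposition

variable {F : Set (Baire → Baire)}

/-- The fibres of `p`, pulled back along the reduction `g` of `A` to `D ∩ A`, form a partition that
cannot witness the decomposition property. So `A` reduces to its part in one piece, and `g` carries
that part into the fibre. -/
lemma exists_inter_red (hF : IsBorelAmenable F) {A : Set Baire} (hA : A ≠ univ)
    (hdec : ¬ HasDecompositionProperty F A) {D : Set Baire} (hDA : Red F A (D ∩ A))
    {p : Baire → ℕ} (hp : ∀ i, {x | p x = i} ∈ charSet F) :
    ∃ i, Red F A (({x | p x = i} ∩ D) ∩ A) := by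
  obtain ⟨g, hg, e⟩ := hDA
  have hpart : IsPartitionOf (charSet F) fun i => g ⁻¹' {x | p x = i} := by
    refine ⟨fun i => hF.preimage_mem_charSet hg (hp i), fun m n hmn => ?_, ?_⟩
    · exact disjoint_left.2 fun x hx hx' => hmn (Eq.trans (Eq.symm hx) hx')
    · exact eq_univ_of_forall fun x => mem_iUnion.2 ⟨p (g x), rfl⟩
  obtain ⟨i, hi⟩ : ∃ i, ¬ SRed F (g ⁻¹' {x | p x = i} ∩ A) A := by
    by_contra! h
    exact hdec ⟨_, hpart, h⟩
  refine ⟨i, hF.red_trans (not_not.1 fun hn => hi ⟨hF.inter_red hA (hpart.1 i), hn⟩) ⟨g, hg, ?_⟩⟩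
  rw [inter_assoc, preimage_inter, ← e]

lemma exists_constant_on (hF : IsBorelAmenable F) {A : Set Baire} (hA : A ≠ univ)
    (hdec : ¬ HasDecompositionProperty F A) {P : Set (Baire → ℕ)} (hP : P.Finite)
    (hPf : ∀ p ∈ P, ∀ i, {x | p x = i} ∈ charSet F) :
    ∃ D ∈ charSet F, Red F A (D ∩ A) ∧ ∀ p ∈ P, ∀ x ∈ D, ∀ y ∈ D, p x = p y := by
  induction P, hP using Set.Finite.induction_on with
  | empty => exact ⟨univ, hF.univ_mem_charSet, by simpa using hF.red_refl A, by simp⟩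
  | @insert p P _ _ ih =>
    obtain ⟨D, hD, hDA, hc⟩ := ih fun q hq => hPf q (mem_insert_of_mem _ hq)
    have hp := hPf p (mem_insert _ _)
    obtain ⟨i, hi⟩ := exists_inter_red hF hA hdec hDA hp
    refine ⟨_, hF.inter_mem_charSet (hp i) hD, hi, ?_⟩
    rintro q (rfl | hq) x hx y hy
    · exact Eq.trans hx.1 (Eq.symm hy.1)
    · exact hc q hq x hx.2 y hy.2

lemma exists_red_into (hF : IsBorelAmenable F) {A D : Set Baire} (hAF : A ∉ charSet F)
    (hD : D ∈ charSet F) (hDA : Red F A (D ∩ A)) :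
    ∃ f ∈ F, (∀ x, f x ∈ D) ∧ ∀ x, f x ∈ A ↔ x ∈ A := by
  classical
  obtain ⟨g, hg, e⟩ := hDA
  -- Points that `g` sends outside `D` are redirected to `d`. If there were no such `d`, then `A = g
  -- ⁻¹' D` would be in `Δ_F`.
  obtain ⟨d, hd, hdA⟩ : ∃ d ∈ D, d ∉ A := by
    by_contra! h
    rw [inter_eq_left.2 h] at e
    exact hAF (e ▸ hF.preimage_mem_charSet hg hD)
  have he : ∀ x, x ∈ A ↔ g x ∈ D ∧ g x ∈ A := fun x => by
    conv_lhs => rw [e]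
    rfl
  refine ⟨_, hF.ite_mem (hF.preimage_mem_charSet hg hD) hg (hF.const_mem d), fun x => ?_,
    fun x => ?_⟩
  · by_cases h : g x ∈ D <;> simp [h, hd]
  · by_cases h : g x ∈ D <;> simp [h, hdA, he x]

/-- One stage of the flip system. The map for `false` is a self-reduction `f` of `A` into a piece
where the first `n` coordinates of all `h ∈ T` are constant; the map for `true` is `f ∘ s`, with `s`
reducing `A` to `Aᶜ`. -/
lemma exists_flip_stage (hF : IsBorelAmenable F)
    (hSLO : ∀ A B : Set Baire, MeasurableSet A → MeasurableSet B → Red L A B ∨ Red L Bᶜ A)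
    {A : Set Baire} (hAF : A ∉ charSet F) (hself : Selfdual F A)
    (hdec : ¬ HasDecompositionProperty F A) (n : ℕ) {T : Set (Baire → Baire)} (hT : T.Finite)
    (hTf : ∀ h ∈ T, HasFibres F h) :
    ∃ E : Bool → Baire → Baire, (∀ b, Resolves F (E b)) ∧ (∀ b, slice 0 ∘ E b ∈ F) ∧
      (∀ x, slice 0 (E false x) ∈ A ↔ x ∈ A) ∧ (∀ x, slice 0 (E true x) ∈ A ↔ x ∉ A) ∧
      ∀ h ∈ T, ∀ k < n, ∀ b x y, h (slice 0 (E b x)) k = h (slice 0 (E b y)) k := by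
  have hA : A ≠ univ := fun h => hAF (h ▸ hF.univ_mem_charSet)
  obtain ⟨D, hD, hDA, hc⟩ := exists_constant_on hF hA hdec
    (P := image2 (fun h k x => h x k) T (Iio n)) (hT.image2 _ (finite_Iio n)) (by
      rintro _ ⟨h, hh, k, -, rfl⟩ i
      exact hTf h hh k i)
  obtain ⟨f, hf, hfD, hfA⟩ := exists_red_into hF hAF hD hDA
  obtain ⟨s, hs, es⟩ := hself
  have hsA : ∀ x, x ∈ A ↔ s x ∉ A := fun x => by
    conv_lhs => rw [es]
    rfl
  obtain ⟨E₀, hE₀, he₀⟩ := hF.exists_resolves_of_mem hSLO hf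
  obtain ⟨E₁, hE₁, he₁⟩ := hF.exists_resolves_of_mem hSLO (hF.comp_mem f hf s hs)
  refine ⟨fun b => bif b then E₁ else E₀, Bool.forall_bool.2 ⟨hE₀, hE₁⟩,
    Bool.forall_bool.2 ⟨?_, ?_⟩, fun x => ?_, fun x => ?_, fun h hh k hk => Bool.forall_bool.2
      ⟨fun x y => ?_, fun x y => ?_⟩⟩
  · rwa [show slice 0 ∘ (bif false then E₁ else E₀) = f from funext he₀]
  · rw [show slice 0 ∘ (bif true then E₁ else E₀) = f ∘ s from funext he₁]
    exact hF.comp_mem f hf s hs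
  · simp [he₀, hfA]
  · have := hsA x
    simp only [cond_true, he₁, Function.comp_apply, hfA]
    tauto
  · simp only [cond_false, he₀]
    exact hc _ ⟨h, hh, k, hk, rfl⟩ _ (hfD _) _ (hfD _)
  · simp only [cond_true, he₁]
    exact hc _ ⟨h, hh, k, hk, rfl⟩ _ (hfD _) _ (hfD _)

/-- Outside the characteristic set, `F`-selfdual sets have the decomposition property. -/
theorem Selfdual.hasDecompositionProperty {Γ : Set (Set Baire)} (hΓ : IsSelfdualBorPointclass Γ)
    (hFS : NoFlipSets Γ) (hF : IsBorelAmenable F)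
    (hSLO : ∀ A B : Set Baire, MeasurableSet A → MeasurableSet B → Red L A B ∨ Red L Bᶜ A)
    {A : Set Baire} (hA : A ∈ Γ) (hAF : A ∉ charSet F) (hself : Selfdual F A) :
    HasDecompositionProperty F A := by
  by_contra hdec
  let State := {T : Set (Baire → Baire) // T.Finite ∧ ∀ h ∈ T, HasFibres F h}
  have stage : ∀ (n : ℕ) (T : State), _ := fun n T =>
    exists_flip_stage hF hSLO hAF hself hdec n T.2.1 T.2.2
  choose E hE hEF hEfalse hEtrue hEc using stage
  -- The state at stage `n` collects all compositions of earlier stages, for both values of each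
  -- bit, ending in an outermost `E`. It stays finite, so one piece can serve all of them.
  let next : ℕ → State → State := fun n T =>
    ⟨range (E n T) ∪ image2 (fun h b => h ∘ slice 0 ∘ E n T b) T.1 univ, by
      refine ⟨(finite_range _).union (T.2.1.image2 _ finite_univ), ?_⟩
      rintro _ (⟨b, rfl⟩ | ⟨h, hh, b, -, rfl⟩)
      · exact (hE n T b).hasFibres
      · exact (T.2.2 h hh).comp hF (hEF n T b)⟩
  let T : ℕ → State := fun n => Nat.rec ⟨∅, finite_empty, by simp⟩ next n
  have hT : ∀ n, (T (n + 1)).1 =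
    range (E n (T n)) ∪ image2 (fun h b => h ∘ slice 0 ∘ E n (T n) b) (T n).1 univ := fun _ => rfl
  have hmem : ∀ (z : ℕ → Bool) (m n : ℕ),
      (fun p => E m (T m) (z m) (iterComp (fun m b => slice 0 ∘ E m (T m) b) z (m + 1) n p)) ∈
        (T (m + 1 + n)).1 := by
    intro z m n
    induction n with
    | zero => exact Or.inl ⟨z m, rfl⟩
    | succ n ih =>
      rw [← add_assoc, hT]
      refine Or.inr ⟨_, ih, z (m + 1 + n), mem_univ _, ?_⟩
      funext p
      rw [iterComp_add]
      rfl
  refine false_of_flip_system hΓ hFS (A := fun _ => A) hA (fun m => E m (T m)) (slice 0)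
    (continuous_slice 0) (fun m b => (hE m (T m) b).isClosed) (fun m => hEfalse m (T m))
    -- After `k` inner maps the composition belongs to the state of stage `m + 1 + k`. The next map
    -- makes its first `m + 1 + k` coordinates constant, among them coordinate `k`.
    (fun m => hEtrue m (T m)) fun m k => ⟨k + 1, fun z p q => ?_⟩
  rw [iterComp_add, iterComp_add]
  exact hEc (m + 1 + k) (T (m + 1 + k)) _ (hmem z m k) k (by omega) _ p q

end Decomposition

/-! ### Minimal sets in a degree -/

section Minimal

variable {F : Set (Baire → Baire)} {Γ : Set (Set Baire)}

lemma IsPartitionOf.exists_index {Δ : Set (Set Baire)} {D : ℕ → Set Baire}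
    (h : IsPartitionOf Δ D) : ∃ p : Baire → ℕ, ∀ i, D i = {x | p x = i} := by
  have hex : ∀ x, ∃ n, x ∈ D n := fun x => mem_iUnion.1 (h.2.2 ▸ mem_univ x)
  choose p hp using hex
  refine ⟨p, fun i => Subset.antisymm (fun x hx => ?_) ?_⟩
  · by_contra hne
    exact disjoint_left.1 (h.2.1 hne) (hp x) hx
  · rintro x rfl
    exact hp x

lemma IsBorelAmenable.mem_of_red (hF : IsBorelAmenable F) (hΓ : IsSelfdualBorPointclass Γ)
    {A B : Set Baire} (hB : B ∈ Γ) (h : Red F A B) : A ∈ Γ := by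
  obtain ⟨f, hf, rfl⟩ := h
  exact hΓ.preimage_mem B hB f (hF.subset_Bor hf)

/-- Sets with the decomposition property are selfdual. -/
theorem HasDecompositionProperty.selfdual (hΓ : IsSelfdualBorPointclass Γ) (hSLO : SLO L Γ)
    (hF : IsBorelAmenable F) {A : Set Baire} (hA : A ∈ Γ)
    (h : HasDecompositionProperty F A) : Selfdual F A := by
  obtain ⟨D, hD, hDA⟩ := h
  have hSLOF : SLO F Γ := fun X hX Y hY =>
    (hSLO X hX Y hY).imp hF.red_of_red_L hF.red_of_red_L
  have h1 : ∀ n, Red F (D n ∩ A) Aᶜ := fun n =>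
    ((hDA n).compl_red hSLOF (hF.mem_of_red hΓ hA (hDA n).1) hA).compl_right
  choose f hf e using h1
  obtain ⟨p, hp⟩ := hD.exists_index
  refine ⟨_, hF.glue (fun i => hp i ▸ hD.1 i) hf, ?_⟩
  ext x
  have hx : x ∈ D (p x) := by rw [hp]; rfl
  change x ∈ A ↔ x ∈ f (p x) ⁻¹' Aᶜ
  rw [← e, mem_inter_iff, and_iff_right hx]

/-- The localizations of an `L`-minimal set with the decomposition property lie strictly
below it. -/
lemma loc_sRed_of_minimal (hΓ : IsSelfdualBorPointclass Γ) (hSLO : SLO L Γ)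
    (hF : IsBorelAmenable F) {B : Set Baire} (hB : B ∈ Γ) (hself : Selfdual F B)
    (hdec : HasDecompositionProperty F B) (hmin : ∀ C, Equiv F C B → ¬ SRed L C B) (k : ℕ) :
    SRed L (loc B k) B := by
  obtain ⟨D, hD, hDB⟩ := hdec
  obtain ⟨p, hp⟩ := hD.exists_index
  refine ⟨loc_red B k, fun hk => ?_⟩
  -- `S` is the sum of the pieces `D n ∩ B`, which are its localizations. It is `F`-equivalent to
  -- `B`, so minimality and the ordering principle give `B ≤_L S` or `B ≤_L Sᶜ`. If `B` reduced to
  -- `loc B k`, it would then reduce to a piece or to the complement of one.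
  obtain ⟨S, hS⟩ : ∃ S : Set Baire, S = {x | tail x ∈ D (x 0) ∩ B} := ⟨_, rfl⟩
  have hloc : ∀ j, loc S j = D j ∩ B := fun j => by rw [hS]; rfl
  have h1 : Red F B S := by
    refine ⟨_, hF.glue (fun i => hp i ▸ hD.1 i) (fun n => hF.mem_of_mem_L (cons_mem_L n)), ?_⟩
    ext x
    have hx : x ∈ D (p x) := by rw [hp]; rfl
    simp [hS, hx]
  have h2 : Red F S B := by
    choose f hf e using fun n => (hDB n).1
    refine ⟨_, hF.glue (p := fun x => x 0) (hF.setOf_apply_mem_charSet 0)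
      (fun n => hF.comp_mem _ (hf n) _ hF.tail_mem), ?_⟩
    ext x
    change x ∈ S ↔ tail x ∈ f (x 0) ⁻¹' B
    rw [← e, hS]
    rfl
  have hBc : Red F Bᶜ B := Red.compl_left hself
  have hSΓ := hF.mem_of_red hΓ hB h2
  have h3 : Red L B S ∨ Red L B Sᶜ := by
    rcases hSLO B hB S hSΓ with h | h
    · exact Or.inl h
    · refine Or.inr (not_not.1 fun hn => hmin Sᶜ ⟨?_, ?_⟩ ⟨h, hn⟩)
      · exact hF.red_of_red_L h
      · exact hF.red_trans hself h1.compl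
  rcases h3 with h | h
  · obtain ⟨j, hj⟩ := exists_loc_red_of_red h k
    rw [hloc] at hj
    exact (hDB j).2 (hF.red_of_red_L (hk.trans hj))
  · obtain ⟨j, hj⟩ := exists_loc_red_of_red h k
    have hj' : Red L (loc B k) (D j ∩ B)ᶜ := hloc j ▸ hj
    exact (hDB j).2 (hF.red_trans hself
      (Red.compl_left (hF.red_of_red_L (hk.trans hj'))))

lemma SRed.compl {A B : Set Baire} (h : SRed F A B) : SRed F Aᶜ Bᶜ :=
  ⟨h.1.compl, fun h' => h.2 (by simpa using h'.compl)⟩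

lemma SRed.trans_red {A B C : Set Baire} (h : SRed L A B) (h' : Red L B C) : SRed L A C :=
  ⟨h.1.trans h', fun hc => h.2 (h'.trans hc)⟩

/-- Complementation is an automorphism of the order and fixes the degree of `B`. -/
lemma SuccessorOf.compl_of_selfdual {B C : Set Baire} (hB : Selfdual L B)
    (h : SuccessorOf L B C) : SuccessorOf L B Cᶜ := by
  refine ⟨h.1.compl.trans_red (Red.compl_left hB), fun ⟨E, h1, h2⟩ => h.2 ⟨Eᶜ, ?_, ?_⟩⟩
  · simpa using h1.compl
  · exact h2.compl.trans_red (Red.compl_left hB)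

/-- A set which is not a successor, and all of whose localizations lie strictly below it, is limit
of countable cofinality. -/
lemma isLimit_and_countableCofinality (hΓ : IsSelfdualBorPointclass Γ) (hSLO : SLO L Γ)
    (hFS : NoFlipSets Γ) {B : Set Baire} (hB : B ∈ Γ) (hne : B ≠ ∅) (huniv : B ≠ univ)
    (hloc : ∀ k, SRed L (loc B k) B) (hsucc : ¬ IsSuccessor L B) :
    IsLimit L B ∧ CountableCofinality L B := by
  refine ⟨⟨hsucc, ?_, ?_⟩, loc B, hloc, fun D hD hDB => ?_⟩
  · rintro ⟨⟨f, -, rfl⟩, -⟩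
    exact huniv rfl
  · rintro ⟨⟨f, -, rfl⟩, -⟩
    exact hne rfl
  -- Room between `D` and `B` pays for the shift: each `shift (loc B k)` reduces to `shift D`, hence
  -- to `E`, and gluing gives `B ≤_L E`.
  · obtain ⟨E, hDE, hEB⟩ : ∃ E, SRed L D E ∧ SRed L E B := by
      by_contra h
      exact hsucc ⟨D, hDB, h⟩
    have hmem : ∀ {X}, Red L X B → X ∈ Γ := by
      rintro X ⟨f, hf, rfl⟩
      exact hΓ.preimage_mem B hB f (continuous_of_mem_L hf).measurable
    have h1 := hDE.shift_red hΓ hSLO hFS (hmem hDB.1) (hmem hEB.1)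
    exact hEB.2 (red_of_shift_loc fun k => (hD k).shift.trans h1)

/-- The position in the Lipschitz hierarchy of an `L`-minimal set with the decomposition
property. -/
theorem selfdual_and_position_of_minimal (hΓ : IsSelfdualBorPointclass Γ) (hSLO : SLO L Γ)
    (hFS : NoFlipSets Γ) (hF : IsBorelAmenable F) {B : Set Baire} (hB : B ∈ Γ)
    (hBF : B ∉ charSet F) (hself : Selfdual F B) (hdec : HasDecompositionProperty F B)
    (hmin : ∀ C, Equiv F C B → ¬ SRed L C B) :
    Selfdual L B ∧
      ((IsLimit L B ∧ CountableCofinality L B) ∨ SuccessorOfNonselfdualPair L B) := by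
  have hloc := loc_sRed_of_minimal hΓ hSLO hF hB hself hdec hmin
  have hsL : Selfdual L B := by
    by_contra hns
    obtain ⟨k, hk⟩ := exists_red_loc hΓ hSLO hFS hB hns
    exact (hloc k).2 hk
  refine ⟨hsL, ?_⟩
  by_cases hsucc : IsSuccessor L B
  · obtain ⟨C, hC⟩ := hsucc
    refine Or.inr ⟨C, fun hsC => ?_, hC, hC.compl_of_selfdual hsL⟩
    have hCΓ := hF.mem_of_red hΓ hB (hF.red_of_red_L hC.1.1)
    have h1 := hC.1.shift_red hΓ hSLO hFS hCΓ hB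
    -- A selfdual `C` lies strictly below `shift C`, so `shift C` already has the degree of the
    -- successor `B`. As `tail ∈ F`, this puts `C` in the `F`-degree of `B`, against minimality.
    have h2 : Red L B (shift C) := by
      by_contra hn
      exact hC.2 ⟨shift C, ⟨red_shift C, hsC.not_shift_red⟩, h1, hn⟩
    have h3 : Red F (shift C) C := ⟨tail, hF.tail_mem, rfl⟩
    exact hmin C ⟨hF.red_of_red_L hC.1.1, hF.red_trans (hF.red_of_red_L h2) h3⟩ hC.1
  · refine Or.inl (isLimit_and_countableCofinality hΓ hSLO hFS hB ?_ ?_ hloc hsucc)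
    · rintro rfl
      exact hBF hF.empty_mem_charSet
    · rintro rfl
      exact hBF hF.univ_mem_charSet

lemma exists_lMinimalIn (hΓ : IsSelfdualBorPointclass Γ) (hSLO : SLO L Γ)
    (hFS : NoFlipSets Γ) (hF : IsBorelAmenable F) {A : Set Baire} (hA : A ∈ Γ) :
    ∃ B, LMinimalIn F A B := by
  obtain ⟨B, hB, hmin⟩ := (wellFounded_sRed hΓ hSLO hFS).has_min (degree F A)
    ⟨A, hF.red_refl A, hF.red_refl A⟩
  exact ⟨B, hB, fun C hC hCB =>
    hmin C hC ⟨hF.mem_of_red hΓ hA hC.1, hF.mem_of_red hΓ hA hB.1, hCB⟩⟩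

end Minimal

end WadgeHierarchy

/-! ### The equivalence. -/

theorem mainTheorem5 (Γ : Set (Set WadgeHierarchy.Baire))
    (hΓ : WadgeHierarchy.IsSelfdualBorPointclass Γ)
    (hSLO : WadgeHierarchy.SLO WadgeHierarchy.L Γ)
    (hFS : WadgeHierarchy.NoFlipSets Γ)
    (F : Set (WadgeHierarchy.Baire → WadgeHierarchy.Baire))
    (hF : WadgeHierarchy.IsBorelAmenable F)
    (A : Set WadgeHierarchy.Baire) (hA : A ∈ Γ) (hAF : A ∉ WadgeHierarchy.charSet F) :
    List.TFAE [
      WadgeHierarchy.Selfdual F A,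
      WadgeHierarchy.HasDecompositionProperty F A,
      ∀ B, WadgeHierarchy.LMinimalIn F A B →
        WadgeHierarchy.Selfdual WadgeHierarchy.L B ∧
          ((WadgeHierarchy.IsLimit WadgeHierarchy.L B ∧
              WadgeHierarchy.CountableCofinality WadgeHierarchy.L B) ∨
            WadgeHierarchy.SuccessorOfNonselfdualPair WadgeHierarchy.L B)] := by
  open WadgeHierarchy in
  have hne : A.Nonempty := nonempty_iff_ne_empty.2 fun h => hAF (h ▸ hF.empty_mem_charSet)
  have huniv : A ≠ univ := fun h => hAF (h ▸ hF.univ_mem_charSet)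
  have hSLOm : ∀ X Y : Set Baire, MeasurableSet X → MeasurableSet Y →
      Red L X Y ∨ Red L Yᶜ X := fun X Y hX hY =>
    hSLO X (mem_of_measurableSet hΓ hA hne huniv hX) Y (mem_of_measurableSet hΓ hA hne huniv hY)
  tfae_have 1 → 2 := fun h => Selfdual.hasDecompositionProperty hΓ hFS hF hSLOm hA hAF h
  tfae_have 2 → 1 := fun h => HasDecompositionProperty.selfdual hΓ hSLO hF hA h
  tfae_have 1 → 3 := by
    rintro h B ⟨hBA, hmin⟩
    have hB := hF.mem_of_red hΓ hA hBA.1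
    have hBF : B ∉ charSet F := fun h' => hAF (hF.mem_charSet_of_red hBA.2 h')
    have hself : Selfdual F B := hF.red_trans hBA.1 (hF.red_trans h hBA.2.compl)
    exact selfdual_and_position_of_minimal hΓ hSLO hFS hF hB hBF hself
      (Selfdual.hasDecompositionProperty hΓ hFS hF hSLOm hB hBF hself)
      fun C hC => hmin C ⟨hF.red_trans hC.1 hBA.1, hF.red_trans hBA.2 hC.2⟩
  tfae_have 3 → 1 := by
    intro h
    -- Well-foundedness ensures that the third condition is not vacuous.
    obtain ⟨B, hB⟩ := exists_lMinimalIn hΓ hSLO hFS hF hA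
    have hBs := hF.red_of_red_L (h B hB).1
    exact hF.red_trans hB.1.2 (hF.red_trans hBs hB.1.1.compl)
  tfae_finish
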